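/- **Setting.** Let $\widetilde h_k(u)=\pi^{-1/4}((k-1)!)^{-1/2}\,\mathrm{He}_{k-1}(\sqrt2\,u)\,e^{-u^2/2}$, $k=1,2,\dots$, be the Hermite functions (with $\mathrm{He}_n(u)=(-1)^n e^{u^2/2}\frac{d^n}{du^n}e^{-u^2/2}$), an orthonormal basis of the complex Hilbert space $\mathbf L_2(\mathbb R,dx)$. For $p\in\mathbb Z$ let $\mathcal H_p=\{\sum_k f_k\widetilde h_k:\ \sum_k|f_k|^2(2k)^p<\infty\}$, so that $\mathcal H_0=\mathbf L_2(\mathbb R,dx)$, and let $\Gamma(\mathcal H_p)=\bigoplus_{n\ge0}\mathcal H_p^{\otimes n}$ be its full Fock space. In coordinates, $\Gamma(\mathcal H_p)$ consists of the families $(f_\alpha)$, indexed by the finite words $\alpha=k_1\cdots k_n$ ($n\ge 0$, $k_i\ge1$), with $\|f\|^2=\sum_\alpha|f_\alpha|^2\prod_{i}(2k_i)^p<\infty$. Put $$\widetilde{\mathcal S}_1=\bigcap_{p\in\mathbb N}\Gamma(\mathcal H_p)\ \subset\ \Gamma(\mathcal H_0)\ \subset\ \widetilde{\mathcal S}_{-1}=\bigcup_{p\in\mathbb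 N}\Gamma(\mathcal H_{-p}),$$ with the projective limit topology on $\widetilde{\mathcal S}_1$ and the (locally convex) inductive limit topology on $\widetilde{\mathcal S}_{-1}$. Let $\mathcal L(\widetilde{\mathcal S}_1,\widetilde{\mathcal S}_{-1})$ be the space of continuous linear maps. For $h\in\mathbf L_2(\mathbb R,dx)$ let $\ell_h f=h\otimes f$ on $\Gamma(\mathcal H_0)$, and let $\ell_h^*$ be its Hilbert space adjoint. Let $m:\mathbb R\to[0,\infty)$ be measurable with $\int_{\mathbb R}\frac{m(u)}{1+u^2}\,du<\infty$, and let $T_m$ be the operator in $\mathbf L_2(\mathbb R,dx)$ given by $\widehat{T_mf}(u)=\sqrt{m(u)}\,\widehat f(u)$ on $\{f:\int m|\widehat f|^2<\infty\}$, where $\widehat f(u)=\int e^{-iux}f(x)\,dx$. For $t<0$ let $1_{[0,t]}$ stand for $-1_{[t,0]}$. **Theorem.** Assume moreover that there are $K\in(0,\infty)$, $b<2$ and $N\in\{0,1,2,\dots\}$ with $$m(u)\le K|u|^{-b}\quad(0<|u|\le1),\qquad m(u)\le K|u|^{2N}\quad(|u|>1).$$ Then $1_{[0,t]}$ belongs to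 the domain of $T_m$ for every $t\in\mathbb R$, and the free process $$X_m(t)=\ell_{T_m1_{[0,t]}}+\ell_{T_m1_{[0,t]}}^*,\qquad t\in\mathbb R,$$ of bounded operators on $\Gamma(\mathcal H_0)$ is differentiable in the following sense: there is a function $W_m:\mathbb R\to\mathcal L(\widetilde{\mathcal S}_1,\widetilde{\mathcal S}_{-1})$ such that for every $f\in\widetilde{\mathcal S}_1$ and every $t\in\mathbb R$ $$\frac{d}{dt}X_m(t)f=\lim_{h\to0}\frac{X_m(t+h)f-X_m(t)f}{h}=W_m(t)f\quad\text{in the topology of }\widetilde{\mathcal S}_{-1}.$$ -/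

import Mathlib

open MeasureTheory Filter Topology
open scoped ENNReal FourierTransform InnerProductSpace

noncomputable section

namespace FreeNoise

/-! ## Weighted `ℓ²` spaces -/

section WeightedL2

variable {ι : Type}

/-- The families `(f i)` of complex numbers with `∑ i, |f i|² a i < ∞`, for a weight `a > 0`. -/
def weightedSubmodule (a : ι → ℝ) [ha : Fact (∀ i, 0 < a i)] : Submodule ℂ (ι → ℂ) where
  carrier := {f | Summable fun i => ‖f i‖ ^ 2 * a i}
  zero_mem' := by
    simp
  add_mem' := by
    intro f g hf hg
    simp only [Set.mem_ofPred_eq] at hf hg ⊢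
    refine Summable.of_nonneg_of_le (fun i => mul_nonneg (sq_nonneg _) (ha.out i).le) (fun i => ?_)
      ((hf.add hg).mul_left 2)
    have h1 : ‖(f + g) i‖ ≤ ‖f i‖ + ‖g i‖ := norm_add_le _ _
    have h2 : ‖(f + g) i‖ ^ 2 ≤ 2 * (‖f i‖ ^ 2 + ‖g i‖ ^ 2) := by
      nlinarith [norm_nonneg ((f + g) i), sq_nonneg (‖f i‖ - ‖g i‖),
        norm_nonneg (f i), norm_nonneg (g i)]
    nlinarith [mul_le_mul_of_nonneg_right h2 (ha.out i).le]
  smul_mem' := by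
    intro c f hf
    simp only [Set.mem_ofPred_eq] at hf ⊢
    refine (hf.mul_left (‖c‖ ^ 2)).congr (fun i => ?_)
    simp only [Pi.smul_apply, smul_eq_mul, norm_mul]
    ring

/-- The Hilbert space `ℓ²(ι, a)` of families with `∑ i, |f i|² a i < ∞`. -/
def WeightedL2 (a : ι → ℝ) [Fact (∀ i, 0 < a i)] : Type := ↥(weightedSubmodule a)

variable (a : ι → ℝ) [ha : Fact (∀ i, 0 < a i)]

instance : AddCommGroup (WeightedL2 a) := inferInstanceAs (AddCommGroup ↥(weightedSubmodule a))

instance : Module ℂ (WeightedL2 a) := inferInstanceAs (Module ℂ ↥(weightedSubmodule a))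

/-- The family of coefficients of an element of `ℓ²(ι, a)`. -/
def coeff : WeightedL2 a →ₗ[ℂ] (ι → ℂ) := (weightedSubmodule a).subtype

theorem coeff_injective : Function.Injective (coeff a) := Subtype.val_injective

/-- A family with `∑ i, |f i|² a i < ∞`, as an element of `ℓ²(ι, a)`. -/
def ofCoeff (f : ι → ℂ) (hf : Summable fun i => ‖f i‖ ^ 2 * a i) : WeightedL2 a := ⟨f, hf⟩

theorem coeff_ofCoeff (f : ι → ℂ) (hf : Summable fun i => ‖f i‖ ^ 2 * a i) :
    coeff a (ofCoeff a f hf) = f := rfl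

theorem summable_coeff (f : WeightedL2 a) : Summable fun i => ‖coeff a f i‖ ^ 2 * a i := f.2

theorem norm_scaled_sq (f : ι → ℂ) (i : ι) :
    ‖(Real.sqrt (a i) : ℂ) * f i‖ ^ 2 = ‖f i‖ ^ 2 * a i := by
  rw [norm_mul, mul_pow, Complex.norm_real, Real.norm_eq_abs, sq_abs,
    Real.sq_sqrt (ha.out i).le, mul_comm]

/-- The map `(f i) ↦ (√(a i) f i)` from `ℓ²(ι, a)` to the unweighted `ℓ²(ι)`. -/
def scale : WeightedL2 a →ₗ[ℂ] lp (fun _ : ι => ℂ) 2 where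
  toFun f := ⟨fun i => (Real.sqrt (a i) : ℂ) * coeff a f i, by
    refine (memℓp_gen_iff (by norm_num)).2 ((summable_coeff a f).congr (fun i => ?_))
    rw [← norm_scaled_sq a (coeff a f) i]
    norm_num⟩
  map_add' f g := by
    ext i
    exact mul_add _ _ _
  map_smul' c f := by
    ext i
    exact mul_left_comm _ _ _

theorem scale_apply (f : WeightedL2 a) (i : ι) :
    (scale a f) i = (Real.sqrt (a i) : ℂ) * coeff a f i := rfl

theorem sqrt_weight_ne_zero (i : ι) : (Real.sqrt (a i) : ℂ) ≠ 0 := by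
  simpa using (Real.sqrt_pos.2 (ha.out i)).ne'

theorem scale_injective : Function.Injective (scale a) := by
  intro f g h
  refine coeff_injective a (funext fun i => ?_)
  have h1 : (scale a f) i = (scale a g) i := by rw [h]
  exact mul_left_cancel₀ (sqrt_weight_ne_zero a i) h1

theorem scale_surjective : Function.Surjective (scale a) := by
  intro g
  have hg : Summable fun i => ‖g i‖ ^ 2 := by
    have := (memℓp_gen_iff (p := 2) (by norm_num)).1 g.2
    exact this.congr (fun i => by norm_num)
  refine ⟨ofCoeff a (fun i => (Real.sqrt (a i) : ℂ)⁻¹ * g i) ?_, ?_⟩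
  · refine hg.congr (fun i => ?_)
    rw [← norm_scaled_sq a (fun i => (Real.sqrt (a i) : ℂ)⁻¹ * g i) i,
      mul_inv_cancel_left₀ (sqrt_weight_ne_zero a i)]
  · ext i
    exact mul_inv_cancel_left₀ (sqrt_weight_ne_zero a i) _

instance : NormedAddCommGroup (WeightedL2 a) :=
  NormedAddCommGroup.induced (WeightedL2 a) (lp (fun _ : ι => ℂ) 2) (scale a) (scale_injective a)

theorem norm_scale (f : WeightedL2 a) : ‖scale a f‖ = ‖f‖ := rfl

instance : NormedSpace ℂ (WeightedL2 a) :=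
  NormedSpace.induced ℂ (WeightedL2 a) (lp (fun _ : ι => ℂ) 2) (scale a)

/-- The inner product `⟪f, g⟫ = ∑ i, conj (f i) g i a i`, linear in the second variable. -/
instance : InnerProductSpace ℂ (WeightedL2 a) where
  inner f g := ⟪scale a f, scale a g⟫_ℂ
  norm_sq_eq_re_inner f := by
    rw [← norm_scale]
    exact norm_sq_eq_re_inner (𝕜 := ℂ) (scale a f)
  conj_inner_symm f g := inner_conj_symm _ _
  add_left f g h := by rw [map_add, inner_add_left]
  smul_left f g c := by rw [map_smul, inner_smul_left]

instance : CompleteSpace (WeightedL2 a) := by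
  let e : WeightedL2 a ≃ₗᵢ[ℂ] lp (fun _ : ι => ℂ) 2 :=
    { LinearEquiv.ofBijective (scale a) ⟨scale_injective a, scale_surjective a⟩ with
      norm_map' := norm_scale a }
  exact (completeSpace_congr (e := e.toLinearEquiv.toEquiv) e.isometry.isUniformEmbedding).2
    inferInstance

theorem norm_sq_eq (f : WeightedL2 a) : ‖f‖ ^ 2 = ∑' i, ‖coeff a f i‖ ^ 2 * a i := by
  have h := lp.norm_rpow_eq_tsum (p := 2) (by norm_num) (scale a f)
  rw [norm_scale] at h
  norm_num at h
  rw [h]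
  exact tsum_congr (fun i => norm_scaled_sq a (coeff a f) i)

end WeightedL2

/-! ## Full Fock spaces and the free field operators -/

section Fock

variable {ι : Type}

/-- The weight of the word `i₁ i₂ ⋯ iₙ` is `a i₁ * a i₂ * ⋯ * a iₙ`. -/
def wordWeight (a : ι → ℝ) (w : List ι) : ℝ := (w.map a).prod

instance (a : ι → ℝ) [ha : Fact (∀ i, 0 < a i)] : Fact (∀ w, 0 < wordWeight a w) :=
  ⟨fun w => by
    unfold wordWeight
    refine List.prod_pos ?_
    intro x hx
    obtain ⟨i, _, rfl⟩ := List.mem_map.1 hx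
    exact ha.out i⟩

/-- The full Fock space `⨁ₙ K^{⊗n}` of `K = ℓ²(ι, a)`, which has the orthogonal basis
`e_i`, `i ∈ ι`, with `‖e_i‖² = a i`. The coefficient at the word `i₁ ⋯ iₙ` is the one of
`e_{i₁} ⊗ ⋯ ⊗ e_{iₙ}`, a vector of square norm `a i₁ ⋯ a iₙ`, and the empty word belongs to the
vacuum `Ω`. -/
abbrev Fock (a : ι → ℝ) [Fact (∀ i, 0 < a i)] : Type := WeightedL2 (wordWeight a)

/-- The coefficients of `c ⊗ f`. -/
def tensorCoeff (c : ι → ℂ) (f : List ι → ℂ) : List ι → ℂ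
  | [] => 0
  | i :: w => c i * f w

variable (a : ι → ℝ) [ha : Fact (∀ i, 0 < a i)]

theorem hasSum_tensorCoeff (c : WeightedL2 a) (f : Fock a) :
    HasSum (fun w => ‖tensorCoeff (coeff a c) (coeff (wordWeight a) f) w‖ ^ 2 * wordWeight a w)
      (‖c‖ ^ 2 * ‖f‖ ^ 2) := by
  have hinj : Function.Injective (fun x : ι × List ι => x.1 :: x.2) := by
    rintro ⟨i, w⟩ ⟨j, v⟩ h
    simpa using h
  rw [← hinj.hasSum_iff]
  · have hc := (summable_coeff a c).hasSum
    have hf := (summable_coeff (wordWeight a) f).hasSum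
    rw [← norm_sq_eq] at hc hf
    have hs : Summable fun x : ι × List ι =>
        (‖coeff a c x.1‖ ^ 2 * a x.1) *
          (‖coeff (wordWeight a) f x.2‖ ^ 2 * wordWeight a x.2) :=
      (summable_coeff a c).mul_of_nonneg (summable_coeff (wordWeight a) f)
        (fun i => mul_nonneg (sq_nonneg _) (ha.out i).le)
        (fun w => mul_nonneg (sq_nonneg _)
          ((inferInstance : Fact (∀ w, 0 < wordWeight a w)).out w).le)
    have key := hc.mul hf hs
    refine key.congr_fun fun x => ?_
    simp only [Function.comp_apply]
    simp only [tensorCoeff, wordWeight, List.map_cons, List.prod_cons, norm_mul]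
    ring
  · intro w hw
    cases w with
    | nil => simp [tensorCoeff]
    | cons i w => exact absurd ⟨(i, w), rfl⟩ hw

/-- The left creation operator `ℓ_c f = c ⊗ f` on the full Fock space of `ℓ²(ι, a)`. -/
def creation (c : WeightedL2 a) : Fock a →L[ℂ] Fock a :=
  LinearMap.mkContinuous
    { toFun := fun f => ofCoeff (wordWeight a)
        (tensorCoeff (coeff a c) (coeff (wordWeight a) f)) (hasSum_tensorCoeff a c f).summable
      map_add' := fun f g => by
        refine coeff_injective (wordWeight a) (funext fun w => ?_)
        cases w with
        | nil => exact (add_zero (0 : ℂ)).symm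
        | cons i w => exact mul_add _ _ _
      map_smul' := fun r f => by
        refine coeff_injective (wordWeight a) (funext fun w => ?_)
        cases w with
        | nil => exact (smul_zero r : r • (0 : ℂ) = 0).symm
        | cons i w => exact mul_left_comm _ _ _ }
    ‖c‖
    (fun f => by
      refine abs_le_of_sq_le_sq' ?_ (by positivity) |>.2
      rw [norm_sq_eq, mul_pow]
      exact (hasSum_tensorCoeff a c f).tsum_eq.le)

/-- The operator `X_c = ℓ_c + ℓ_c^*`, with the Hilbert space adjoint in the Fock space. -/
def freeField (c : WeightedL2 a) : Fock a →L[ℂ] Fock a :=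
  creation a c + ContinuousLinearMap.adjoint (creation a c)

end Fock

/-! ## Hermite functions -/

section Hermite

open Polynomial

theorem integrable_poly_gauss (P : Polynomial ℝ) {c : ℝ} (hc : 0 < c) :
    Integrable fun x : ℝ => P.eval x * Real.exp (-c * x ^ 2) := by
  induction P using Polynomial.induction_on' with
  | add p q hp hq =>
    refine (hp.add hq).congr (ae_of_all _ fun x => ?_)
    simp [add_mul]
  | monomial n r =>
    have h := (integrable_rpow_mul_exp_neg_mul_sq hc (s := n)
      (by have : (0 : ℝ) ≤ n := Nat.cast_nonneg n
          linarith)).const_mul r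
    refine h.congr (ae_of_all _ fun x => ?_)
    simp [Real.rpow_natCast, mul_assoc]

/-- The Hermite polynomials with real coefficients. -/
def hermiteR (n : ℕ) : Polynomial ℝ := (hermite n).map (Int.castRingHom ℝ)

theorem hermiteR_succ (n : ℕ) : hermiteR (n + 1) = X * hermiteR n - derivative (hermiteR n) := by
  simp [hermiteR, hermite_succ, derivative_map]

theorem integral_hermite_succ (n : ℕ) (Q : Polynomial ℝ) :
    ∫ x : ℝ, (hermiteR (n + 1) * Q).eval x * Real.exp (-(1 / 2) * x ^ 2) =
      ∫ x : ℝ, (hermiteR n * derivative Q).eval x * Real.exp (-(1 / 2) * x ^ 2) := by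
  have hd : ∀ x : ℝ, HasDerivAt
      (fun x => (hermiteR n * Q).eval x * Real.exp (-(1 / 2) * x ^ 2))
      ((hermiteR n * derivative Q - hermiteR (n + 1) * Q).eval x
        * Real.exp (-(1 / 2) * x ^ 2)) x := by
    intro x
    have h1 := (hermiteR n * Q).hasDerivAt x
    have h2 : HasDerivAt (fun x : ℝ => Real.exp (-(1 / 2) * x ^ 2))
        (Real.exp (-(1 / 2) * x ^ 2) * (-(1 / 2) * (2 * x))) x := by
      have := ((hasDerivAt_pow 2 x).const_mul (-(1 / 2) : ℝ)).exp
      simpa using this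
    refine (h1.mul h2).congr_deriv ?_
    simp only [hermiteR_succ, derivative_mul, eval_sub, eval_mul, eval_add, eval_X]
    ring
  have h0 : ∫ x : ℝ, (hermiteR n * derivative Q - hermiteR (n + 1) * Q).eval x *
      Real.exp (-(1 / 2) * x ^ 2) = 0 := integral_eq_zero_of_hasDerivAt_of_integrable hd
    (integrable_poly_gauss _ (by norm_num)) (integrable_poly_gauss _ (by norm_num))
  have h1 := integral_sub (integrable_poly_gauss (hermiteR n * derivative Q)
    (c := 1 / 2) (by norm_num)) (integrable_poly_gauss (hermiteR (n + 1) * Q) (c := 1 / 2) (by norm_num))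
  rw [← sub_eq_zero, ← neg_sub, ← h1, neg_eq_zero, ← h0]
  refine integral_congr_ae (ae_of_all _ fun x => ?_)
  beta_reduce
  rw [eval_sub, sub_mul]

theorem integral_hermite_mul (n : ℕ) (Q : Polynomial ℝ) :
    ∫ x : ℝ, (hermiteR n * Q).eval x * Real.exp (-(1 / 2) * x ^ 2) =
      ∫ x : ℝ, (derivative^[n] Q).eval x * Real.exp (-(1 / 2) * x ^ 2) := by
  induction n generalizing Q with
  | zero => simp [hermiteR]
  | succ n ih => rw [integral_hermite_succ, ih, Function.iterate_succ_apply]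

theorem hermiteR_natDegree (n : ℕ) : (hermiteR n).natDegree = n := by
  rw [hermiteR, (hermite_monic n).natDegree_map, natDegree_hermite]

theorem integral_hermite_hermite {m n : ℕ} (h : m ≤ n) :
    ∫ x : ℝ, (hermiteR n * hermiteR m).eval x * Real.exp (-(1 / 2) * x ^ 2) =
      if m = n then (n.factorial : ℝ) * Real.sqrt (2 * Real.pi) else 0 := by
  rw [integral_hermite_mul]
  split_ifs with hmn
  · subst hmn
    have h1 : derivative^[m] (hermiteR m) = C (m.factorial : ℝ) := by
      have hdeg : (derivative^[m] (hermiteR m)).natDegree ≤ 0 := by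
        refine (natDegree_iterate_derivative _ _).trans ?_
        rw [hermiteR_natDegree]
        omega
      rw [eq_C_of_natDegree_le_zero hdeg, coeff_iterate_derivative]
      have hmon : (hermiteR m).coeff m = 1 := by
        simp [hermiteR]
      simp [hmon, Nat.descFactorial_self]
    rw [h1]
    simp only [eval_C]
    rw [integral_const_mul, integral_gaussian]
    congr 2
    ring
  · rw [iterate_derivative_eq_zero (by rw [hermiteR_natDegree]; omega)]
    simp

/-- The Hermite functions `π^{-1/4} (n!)^{-1/2} Heₙ(√2 u) e^{-u²/2}`, `n = 0, 1, 2, …`. -/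
def hermiteFun (n : ℕ) (u : ℝ) : ℝ :=
  aeval (Real.sqrt 2 * u) (hermite n) * Real.exp (-u ^ 2 / 2) /
    (Real.pi ^ (1 / 4 : ℝ) * Real.sqrt n.factorial)

theorem hermiteFun_mul (m n : ℕ) (u : ℝ) :
    hermiteFun n u * hermiteFun m u =
      ((hermiteR n * hermiteR m).eval (Real.sqrt 2 * u) *
        Real.exp (-(1 / 2) * (Real.sqrt 2 * u) ^ 2)) *
      (Real.pi ^ (1 / 2 : ℝ) * (Real.sqrt n.factorial * Real.sqrt m.factorial))⁻¹ := by
  have h1 : ∀ n : ℕ, aeval (Real.sqrt 2 * u) (hermite n) = (hermiteR n).eval (Real.sqrt 2 * u) := by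
    intro n
    simp [hermiteR, aeval_def, eval_map]
  have h2 : Real.exp (-(1 / 2) * (Real.sqrt 2 * u) ^ 2) =
      Real.exp (-u ^ 2 / 2) * Real.exp (-u ^ 2 / 2) := by
    rw [← Real.exp_add, mul_pow, Real.sq_sqrt (by norm_num)]
    congr 1
    ring
  have h3 : Real.pi ^ (1 / 2 : ℝ) = Real.pi ^ (1 / 4 : ℝ) * Real.pi ^ (1 / 4 : ℝ) := by
    rw [← Real.rpow_add Real.pi_pos]
    norm_num
  rw [h2, h3]
  simp only [hermiteFun, h1, eval_mul, div_eq_mul_inv, mul_inv]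
  ring

theorem integrable_hermiteFun_mul (m n : ℕ) :
    Integrable fun u => hermiteFun n u * hermiteFun m u := by
  simp only [hermiteFun_mul]
  exact ((integrable_poly_gauss _ (by norm_num)).comp_mul_left' (by positivity)).mul_const _

theorem integral_hermiteFun_mul (m n : ℕ) :
    ∫ u, hermiteFun n u * hermiteFun m u = if m = n then 1 else 0 := by
  wlog h : m ≤ n generalizing m n with H
  · have := H n m (by omega)
    simp only [mul_comm (hermiteFun n _)]
    rw [this]
    simp only [eq_comm]
  simp only [hermiteFun_mul]
  rw [integral_mul_const, Measure.integral_comp_mul_left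
    (fun x => (hermiteR n * hermiteR m).eval x * Real.exp (-(1 / 2) * x ^ 2)),
    integral_hermite_hermite h]
  split_ifs with hmn
  · subst hmn
    rw [abs_of_pos (by positivity), Real.mul_self_sqrt (by positivity), ← Real.sqrt_eq_rpow,
      Real.sqrt_mul (by norm_num), smul_eq_mul]
    have := Real.pi_pos
    field_simp
  · simp

theorem continuous_hermiteFun (n : ℕ) : Continuous (hermiteFun n) := by
  unfold hermiteFun
  have : Continuous fun u : ℝ => aeval (Real.sqrt 2 * u) (hermite n) :=
    (Polynomial.continuous_aeval _).comp (by fun_prop)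
  fun_prop

theorem memLp_hermiteFun (n : ℕ) : MemLp (fun u => (hermiteFun n u : ℂ)) 2 := by
  suffices h : MemLp (hermiteFun n) 2 from h.ofReal
  rw [memLp_two_iff_integrable_sq (continuous_hermiteFun n).aestronglyMeasurable]
  simpa [sq] using integrable_hermiteFun_mul n n

/-- The Hermite functions as elements of the complex Hilbert space `L²(ℝ)`. -/
def hermiteLp (n : ℕ) : Lp ℂ 2 (volume : Measure ℝ) := (memLp_hermiteFun n).toLp _

theorem orthonormal_hermiteLp : Orthonormal ℂ hermiteLp := by
  rw [orthonormal_iff_ite]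
  intro m n
  rw [L2.inner_def]
  have h : (fun u => ⟪hermiteLp m u, hermiteLp n u⟫_ℂ) =ᵐ[volume]
      fun u => ((hermiteFun m u * hermiteFun n u : ℝ) : ℂ) := by
    filter_upwards [(memLp_hermiteFun m).coeFn_toLp, (memLp_hermiteFun n).coeFn_toLp] with u h1 h2
    rw [hermiteLp, hermiteLp, h1, h2]
    simp [mul_comm]
  rw [integral_congr_ae h, integral_complex_ofReal, integral_hermiteFun_mul]
  simp only [eq_comm (a := n)]
  split_ifs <;> simp

end Hermite

/-! ## The spaces `H_p`, `Γ(H_p)` and the non-commutative Kondratiev spaces -/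

section Kondratiev

/-- The weight `(2k)^p` of the `k`-th Hermite function, `k = n + 1 = 1, 2, …`. -/
def hermiteWeight (p : ℤ) (n : ℕ) : ℝ := (2 * ((n : ℝ) + 1)) ^ p

instance (p : ℤ) : Fact (∀ n, 0 < hermiteWeight p n) :=
  ⟨fun n => zpow_pos (by positivity) p⟩

/-- `H_p`, given by the Hermite coefficients: `∑ |f_k|² (2k)^p < ∞`. -/
abbrev HermiteSpace (p : ℤ) : Type := WeightedL2 (hermiteWeight p)

/-- The full Fock space `Γ(H_p)`. -/
abbrev FockH (p : ℤ) : Type := Fock (hermiteWeight p)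

/-- The families of coefficients of the elements of `Γ(H_p)`. -/
abbrev fockSubmodule (p : ℤ) : Submodule ℂ (List ℕ → ℂ) :=
  weightedSubmodule (wordWeight (hermiteWeight p))

theorem one_le_wordWeight {p : ℤ} (hp : 0 ≤ p) (w : List ℕ) :
    1 ≤ wordWeight (hermiteWeight p) w := by
  induction w with
  | nil => simp [wordWeight]
  | cons n w ih =>
    have h : 1 ≤ hermiteWeight p n := one_le_zpow₀ (by linarith [(Nat.cast_nonneg n : (0:ℝ) ≤ n)]) hp
    simpa [wordWeight] using one_le_mul_of_one_le_of_one_le h ih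

theorem wordWeight_mono {p q : ℤ} (h : p ≤ q) (w : List ℕ) :
    wordWeight (hermiteWeight p) w ≤ wordWeight (hermiteWeight q) w := by
  induction w with
  | nil => simp [wordWeight]
  | cons n w ih =>
    have h1 : hermiteWeight p n ≤ hermiteWeight q n :=
      zpow_le_zpow_right₀ (by linarith [(Nat.cast_nonneg n : (0:ℝ) ≤ n)]) h
    have hp := (inferInstance : Fact (∀ n, 0 < hermiteWeight q n)).out n
    have hw := (inferInstance : Fact (∀ w, 0 < wordWeight (hermiteWeight p) w)).out w
    simpa [wordWeight] using mul_le_mul h1 ih hw.le hp.le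

theorem fockSubmodule_anti {p q : ℤ} (h : p ≤ q) : fockSubmodule q ≤ fockSubmodule p := by
  intro f hf
  exact Summable.of_nonneg_of_le
    (fun w => mul_nonneg (sq_nonneg _)
      ((inferInstance : Fact (∀ w, 0 < wordWeight (hermiteWeight p) w)).out w).le)
    (fun w => mul_le_mul_of_nonneg_left (wordWeight_mono h w) (sq_nonneg _)) hf

/-- The families of coefficients of the elements of `⋂ₚ Γ(H_p)`. -/
def testSubmodule : Submodule ℂ (List ℕ → ℂ) := ⨅ p : ℕ, fockSubmodule p

/-- The families of coefficients of the elements of `⋃ₚ Γ(H_{-p})`. -/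
def distributionSubmodule : Submodule ℂ (List ℕ → ℂ) where
  carrier := {f | ∃ p : ℕ, f ∈ fockSubmodule (-(p : ℤ))}
  zero_mem' := ⟨0, zero_mem _⟩
  add_mem' := by
    rintro f g ⟨p, hf⟩ ⟨q, hg⟩
    refine ⟨max p q, add_mem (fockSubmodule_anti ?_ hf) (fockSubmodule_anti ?_ hg)⟩ <;>
      simp
  smul_mem' := by
    rintro c f ⟨p, hf⟩
    exact ⟨p, Submodule.smul_mem _ c hf⟩

/-- The space `S̃₁ = ⋂ₚ Γ(H_p)` of non-commutative stochastic test functions. -/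
def TestSpace : Type := ↥testSubmodule

instance : AddCommGroup TestSpace := inferInstanceAs (AddCommGroup ↥testSubmodule)

instance : Module ℂ TestSpace := inferInstanceAs (Module ℂ ↥testSubmodule)

/-- The inclusion of `S̃₁` into `Γ(H_p)`. -/
def testToFock (p : ℕ) : TestSpace →ₗ[ℂ] FockH p :=
  Submodule.inclusion (iInf_le (fun p : ℕ => fockSubmodule p) p)

/-- The projective limit topology: the coarsest one for which all the inclusions of `S̃₁` into the
Hilbert spaces `Γ(H_p)` are continuous. -/
instance : TopologicalSpace TestSpace :=
  ⨅ p : ℕ, TopologicalSpace.induced (testToFock p) inferInstance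

/-- The space `S̃₋₁ = ⋃ₚ Γ(H_{-p})` of non-commutative stochastic distributions. -/
def DistributionSpace : Type := ↥distributionSubmodule

instance : AddCommGroup DistributionSpace := inferInstanceAs (AddCommGroup ↥distributionSubmodule)

instance : Module ℂ DistributionSpace := inferInstanceAs (Module ℂ ↥distributionSubmodule)

/-- The inclusion of `Γ(H_{-p})` into `S̃₋₁`. -/
def fockToDistribution (p : ℕ) : FockH (-(p : ℤ)) →ₗ[ℂ] DistributionSpace :=
  Submodule.inclusion (p := fockSubmodule (-(p : ℤ))) (p' := distributionSubmodule)
    (fun _ hf => ⟨p, hf⟩)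

/-- The inductive limit topology: the finest locally convex vector space topology for which all the
inclusions of the Hilbert spaces `Γ(H_{-p})` into `S̃₋₁` are continuous. -/
instance : TopologicalSpace DistributionSpace :=
  sInf {τ | @IsTopologicalAddGroup DistributionSpace τ _ ∧ @ContinuousSMul ℂ DistributionSpace _ _ τ ∧
    @LocallyConvexSpace ℝ DistributionSpace _ _ _ _ τ ∧
    ∀ p : ℕ, @Continuous (FockH (-(p : ℤ))) DistributionSpace _ τ (fockToDistribution p)}

/-- The inclusion of the non-commutative white noise space `Γ(H_0)` into `S̃₋₁`. -/
def whiteNoiseToDistribution : FockH 0 →ₗ[ℂ] DistributionSpace :=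
  Submodule.inclusion (p := fockSubmodule 0) (p' := distributionSubmodule)
    (fun _ hf => ⟨0, by simpa using hf⟩)

/-- The inclusion of `S̃₁` into the non-commutative white noise space `Γ(H_0)`. -/
def testToWhiteNoise : TestSpace →ₗ[ℂ] FockH 0 := testToFock 0

end Kondratiev

/-! ## The process `X_m` -/

section FreeProc

/-- The Hilbert space `L²(ℝ, dx)` of complex valued functions. -/
abbrev L2R : Type := Lp ℂ 2 (volume : Measure ℝ)

/-- The identification of `L²(ℝ, dx)` with `H_0`: `g` is sent to `(⟪h_n, g⟫)_n`, the coefficients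
of `g = ∑ ⟪h_n, g⟫ h_n` in the basis of Hermite functions. -/
def hermiteCoeff (g : L2R) : HermiteSpace 0 :=
  ofCoeff (hermiteWeight 0) (fun n => ⟪hermiteLp n, g⟫_ℂ) (by
    simpa [hermiteWeight] using orthonormal_hermiteLp.inner_products_summable g)

/-- The function on the Fourier side that defines `T_m f`. Mathlib's transform
`𝓕 f v = ∫ exp(-2πixv) f(x) dx` is related to `f̂ u = ∫ exp(-iux) f(x) dx` by `𝓕 f v = f̂ (2πv)`, so
that the definition `(T_m f)^ u = √(m u) f̂ u` reads `𝓕 (T_m f) v = √(m (2πv)) 𝓕 f v`. -/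
def symbolMul (m : ℝ → ℝ) (f : L2R) (v : ℝ) : ℂ :=
  (Real.sqrt (m (2 * Real.pi * v)) : ℂ) * (𝓕 f : L2R) v

theorem symbolMul_add (m : ℝ → ℝ) (f g : L2R) :
    symbolMul m (f + g) =ᵐ[volume] symbolMul m f + symbolMul m g := by
  rw [show symbolMul m (f + g) = fun v => (Real.sqrt (m (2 * Real.pi * v)) : ℂ) *
    (𝓕 f + 𝓕 g : L2R) v by unfold symbolMul; rw [FourierTransform.fourier_add]]
  filter_upwards [Lp.coeFn_add (𝓕 f : L2R) (𝓕 g)] with v hv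
  simp only [hv, Pi.add_apply, symbolMul, mul_add]

theorem symbolMul_smul (m : ℝ → ℝ) (c : ℂ) (f : L2R) :
    symbolMul m (c • f) =ᵐ[volume] c • symbolMul m f := by
  rw [show symbolMul m (c • f) = fun v => (Real.sqrt (m (2 * Real.pi * v)) : ℂ) *
    (c • 𝓕 f : L2R) v by unfold symbolMul; rw [FourierTransform.fourier_smul]]
  filter_upwards [Lp.coeFn_smul c (𝓕 f : L2R)] with v hv
  simp only [hv, Pi.smul_apply, symbolMul, smul_eq_mul]
  ring

/-- The domain of `T_m`: those `f ∈ L²(ℝ)` with `√m f̂ ∈ L²(ℝ)`. -/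
def domT (m : ℝ → ℝ) : Submodule ℂ L2R where
  carrier := {f | MemLp (symbolMul m f) 2 volume}
  zero_mem' := by
    have h := symbolMul_smul m 0 0
    rw [zero_smul, zero_smul] at h
    exact (memLp_congr_ae h).2 MemLp.zero
  add_mem' := by
    intro f g hf hg
    rw [Set.mem_ofPred_eq] at hf hg ⊢
    exact (memLp_congr_ae (symbolMul_add m f g)).2 (hf.add hg)
  smul_mem' := by
    intro c f hf
    rw [Set.mem_ofPred_eq] at hf ⊢
    exact (memLp_congr_ae (symbolMul_smul m c f)).2 (hf.const_smul c)

/-- The operator `T_m` in `L²(ℝ)`, with `(T_m f)^ = √m f̂`. -/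
def opT (m : ℝ → ℝ) : L2R →ₗ.[ℂ] L2R where
  domain := domT m
  toFun :=
    { toFun := fun f => 𝓕⁻ (MemLp.toLp (symbolMul m f.1) f.2 : L2R)
      map_add' := fun f g => by
        rw [← FourierTransform.fourierInv_add, ← MemLp.toLp_add f.2 g.2]
        congr 1
        exact MemLp.toLp_congr _ _ (symbolMul_add m f.1 g.1)
      map_smul' := fun c f => by
        rw [RingHom.id_apply, ← FourierTransform.fourierInv_smul,
          ← MemLp.toLp_const_smul c f.2]
        congr 1
        exact MemLp.toLp_congr _ _ (symbolMul_smul m c f.1) }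

/-- The function `1_{[0,t]}` in `L²(ℝ)`, which is `-1_{[t,0]}` for `t < 0`, so that
`∫ f 1_{[0,t]} = ∫_0^t f` for every real `t`. -/
def signedIndicator (t : ℝ) : L2R :=
  indicatorConstLp 2 (measurableSet_Icc (a := (0 : ℝ)) (b := t)) measure_Icc_lt_top.ne 1 -
    indicatorConstLp 2 (measurableSet_Icc (a := t) (b := (0 : ℝ))) measure_Icc_lt_top.ne 1

/-- The free process `X_m(t) = ℓ_{T_m 1_{[0,t]}} + ℓ_{T_m 1_{[0,t]}}^*`, a family of bounded
operators in `Γ(L²(ℝ)) = Γ(H_0)`, for an `m` such that all the functions `1_{[0,t]}` belong to the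
domain of `T_m`. -/
def freeProcess (m : ℝ → ℝ) (hm : ∀ t, signedIndicator t ∈ (opT m).domain) (t : ℝ) :
    FockH 0 →L[ℂ] FockH 0 :=
  freeField (hermiteWeight 0) (hermiteCoeff (opT m ⟨signedIndicator t, hm t⟩))

end FreeProc

end FreeNoise

end

/-!
The operator `T_m` is symmetric, so formally `⟪h_n, T_m 1_{[0,t]}⟫ = ∫₀ᵗ (T_m h_n)^*`. On the
Fourier side `T_m h_n` is `√m(2πv) 𝓕 h_n(v)`, which is integrable even when it is not square
integrable: by AM-GM with the weight `1 + (2πv)²` its `L¹` norm is at most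
`½ (∫ (1 + (2πv)²) |𝓕 h_n(v)|² dv + ∫ m(2πv) / (1 + (2πv)²) dv)`, and the first of these integrals
is `‖h_n‖² + ‖h_n'‖² ≤ 2(n + 1)`. Hence the `n`-th Hermite coefficient of `T_m 1_{[0,t]}` is
continuously differentiable in `t`, with a Lipschitz constant that grows linearly in `n`, and by
dominated convergence `t ↦ T_m 1_{[0,t]}` is differentiable as a map into `H_{-4}`.

For each `p ≥ 0` the field operator `ℓ_c + ℓ_c^*` makes sense as a bounded operator from `Γ(H_p)`
to `Γ(H_{-p})` for every `c ∈ H_{-p}`, because `H_{-p}` is the dual of `H_p`. It depends on `c` in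
a bounded real linear way, and so the derivative of `T_m 1_{[0,t]}` in `H_{-4}` gives the derivative
of the free process.
-/

noncomputable section

namespace FreeNoise

/-! ### Weighted `ℓ²` spaces -/

section WeightedL2

variable {ι : Type} (a b : ι → ℝ) [ha : Fact (∀ i, 0 < a i)] [Fact (∀ i, 0 < b i)]

/-- The diagonal operator `(f i) ↦ (μ i f i)` from `ℓ²(ι, b)` to `ℓ²(ι, a)`: for `μ = 1` an
inclusion, and for `μ = b = a⁻¹` the identification of `ℓ²(ι, b)` with its dual space. -/
def diagonal (μ : ι → ℝ) (h : ∀ i, μ i ^ 2 * a i ≤ b i) : WeightedL2 b →L[ℂ] WeightedL2 a :=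
  have hle (f : WeightedL2 b) (i : ι) :
      ‖(μ i : ℂ) * coeff b f i‖ ^ 2 * a i ≤ ‖coeff b f i‖ ^ 2 * b i := by
    rw [norm_mul, Complex.norm_real, mul_pow, Real.norm_eq_abs, sq_abs, mul_comm (μ i ^ 2),
      mul_assoc]
    exact mul_le_mul_of_nonneg_left (h i) (sq_nonneg _)
  have hs (f : WeightedL2 b) : Summable fun i => ‖(μ i : ℂ) * coeff b f i‖ ^ 2 * a i :=
    (summable_coeff b f).of_nonneg_of_le
      (fun i => mul_nonneg (sq_nonneg _) (ha.out i).le) (hle f)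
  LinearMap.mkContinuous
    { toFun := fun f => ofCoeff a (fun i => (μ i : ℂ) * coeff b f i) (hs f)
      map_add' := fun _ _ => coeff_injective a (funext fun _ => mul_add _ _ _)
      map_smul' := fun _ _ => coeff_injective a (funext fun _ => mul_left_comm _ _ _) }
    1 fun f => by
      rw [one_mul]
      refine le_of_sq_le_sq ?_ (norm_nonneg _)
      rw [norm_sq_eq, norm_sq_eq]
      exact (hs f).tsum_le_tsum (hle f) (summable_coeff b f)

theorem coeff_diagonal (μ : ι → ℝ) (h : ∀ i, μ i ^ 2 * a i ≤ b i) (f : WeightedL2 b) (i : ι) :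
    coeff a (diagonal a b μ h f) i = μ i * coeff b f i := rfl

/-- The inclusion of `ℓ²(ι, b)` into `ℓ²(ι, a)`, for `a ≤ b`. -/
def inclusion (h : ∀ i, a i ≤ b i) : WeightedL2 b →L[ℂ] WeightedL2 a :=
  diagonal a b 1 (by simpa using h)

theorem coeff_inclusion (h : ∀ i, a i ≤ b i) (f : WeightedL2 b) :
    coeff a (inclusion a b h f) = coeff b f := by
  ext i
  simp [inclusion, coeff_diagonal]

theorem inner_eq_tsum (f g : WeightedL2 a) :
    ⟪f, g⟫_ℂ = ∑' i, starRingEnd ℂ (coeff a f i) * coeff a g i * a i := by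
  change ⟪scale a f, scale a g⟫_ℂ = _
  rw [lp.inner_eq_tsum]
  refine tsum_congr fun i => ?_
  have h : (Real.sqrt (a i) : ℂ) * (Real.sqrt (a i) : ℂ) = a i := by
    rw [← Complex.ofReal_mul, Real.mul_self_sqrt (ha.out i).le]
  rw [scale_apply, scale_apply, RCLike.inner_apply, map_mul, Complex.conj_ofReal]
  linear_combination (starRingEnd ℂ (coeff a f i) * coeff a g i) * h

/-- The vector of `ℓ²(ι, a)` with coefficient `1` at `i` and `0` elsewhere, of norm `√(a i)`. -/
def single [DecidableEq ι] (i : ι) : WeightedL2 a :=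
  ofCoeff a (Pi.single i 1) (summable_of_ne_finset_zero (s := {i}) fun j hj => by
    rw [Finset.notMem_singleton] at hj
    simp [hj])

theorem coeff_single [DecidableEq ι] (i : ι) : coeff a (single a i) = Pi.single i 1 := rfl

theorem inner_single [DecidableEq ι] (i : ι) (f : WeightedL2 a) :
    ⟪single a i, f⟫_ℂ = coeff a f i * a i := by
  rw [inner_eq_tsum, tsum_eq_single i]
  · simp [coeff_single]
  · intro j hj
    simp [coeff_single, hj]

theorem coeff_real_smul (r : ℝ) (f : WeightedL2 a) (i : ι) :
    coeff a (r • f) i = r • coeff a f i := by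
  rw [← Complex.coe_smul, map_smul, Pi.smul_apply, Complex.coe_smul]

theorem tendsto_of_dominated_coeff {α : Type*} {l : Filter α} {x : α → WeightedL2 a}
    {y : WeightedL2 a} {B : ι → ℝ} (hB : Summable fun i => B i ^ 2 * a i)
    (hbound : ∀ s i, ‖coeff a (x s) i - coeff a y i‖ ≤ B i)
    (hlim : ∀ i, Tendsto (fun s => coeff a (x s) i) l (𝓝 (coeff a y i))) :
    Tendsto x l (𝓝 y) := by
  rw [tendsto_iff_norm_sub_tendsto_zero]
  have hsq : Tendsto (fun s => ‖x s - y‖ ^ 2) l (𝓝 (∑' _ : ι, (0 : ℝ))) := by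
    simp only [norm_sq_eq, map_sub, Pi.sub_apply]
    refine tendsto_tsum_of_dominated_convergence hB (fun i => ?_)
      (Eventually.of_forall fun s i => ?_)
    · simpa using (((hlim i).sub_const (coeff a y i)).norm.pow 2).mul_const (a i)
    · have hi := (ha.out i).le
      rw [Real.norm_of_nonneg (by positivity)]
      gcongr
      exact hbound s i
  simpa [Real.sqrt_sq] using hsq.sqrt

theorem coeff_slope (x : ℝ → WeightedL2 a) (t s : ℝ) (i : ι) :
    coeff a (slope x t s) i = slope (fun r => coeff a (x r) i) t s := by
  simp only [slope_def_module, coeff_real_smul, map_sub, Pi.sub_apply]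

theorem differentiableAt_of_coeff {x : ℝ → WeightedL2 a} {t : ℝ} {B : ι → ℝ}
    (hB : Summable fun i => B i ^ 2 * a i) (hB_nonneg : ∀ i, 0 ≤ B i)
    (hlip : ∀ i s r, ‖coeff a (x s) i - coeff a (x r) i‖ ≤ B i * |s - r|)
    (hdiff : ∀ i, DifferentiableAt ℝ (fun s => coeff a (x s) i) t) :
    DifferentiableAt ℝ x t := by
  set x' : ι → ℂ := fun i => deriv (fun s => coeff a (x s) i) t
  have hx' (i : ι) : ‖x' i‖ ≤ B i :=
    norm_deriv_le_of_lip' (hB_nonneg i) (Eventually.of_forall fun s => hlip i s t)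
  have hslope (s : ℝ) (i : ι) : ‖slope (fun r => coeff a (x r) i) t s‖ ≤ B i := by
    rw [slope_def_module, norm_smul, norm_inv, Real.norm_eq_abs]
    exact inv_mul_le_of_le_mul₀ (abs_nonneg _) (hB_nonneg i) ((hlip i s t).trans_eq (mul_comm _ _))
  have hx'_sum : Summable fun i => ‖x' i‖ ^ 2 * a i := by
    refine hB.of_nonneg_of_le (fun i => mul_nonneg (sq_nonneg _) (ha.out i).le) fun i => ?_
    exact mul_le_mul_of_nonneg_right (pow_le_pow_left₀ (norm_nonneg _) (hx' i) 2) (ha.out i).le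
  refine HasDerivAt.differentiableAt (f' := ofCoeff a x' hx'_sum) ?_
  rw [hasDerivAt_iff_tendsto_slope]
  refine tendsto_of_dominated_coeff a (B := fun i => 2 * B i) ?_ (fun s i => ?_) fun i => ?_
  · exact (hB.mul_left 4).congr fun i => by ring
  · rw [coeff_slope, coeff_ofCoeff, two_mul]
    exact (norm_sub_le _ _).trans (add_le_add (hslope s i) (hx' i))
  · simp only [coeff_slope]
    exact hasDerivAt_iff_tendsto_slope.1 (hdiff i).hasDerivAt

end WeightedL2

/-! ### Creation and annihilation operators -/

section Fock

variable {ι : Type}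

theorem wordWeight_cons (a : ι → ℝ) (i : ι) (w : List ι) :
    wordWeight a (i :: w) = a i * wordWeight a w := by
  simp [wordWeight]

theorem wordWeight_mul_wordWeight_eq_one {a b : ι → ℝ} (hab : ∀ i, a i * b i = 1) (w : List ι) :
    wordWeight a w * wordWeight b w = 1 := by
  simp [wordWeight, ← List.prod_map_mul, hab]

variable (a b : ι → ℝ) [Fact (∀ i, 0 < a i)] [Fact (∀ i, 0 < b i)]

theorem wordWeight_pos (w : List ι) : 0 < wordWeight a w :=
  (inferInstance : Fact (∀ w, 0 < wordWeight a w)).out w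

theorem coeff_creation (c : WeightedL2 a) (f : Fock a) :
    coeff (wordWeight a) (creation a c f) =
      tensorCoeff (coeff a c) (coeff (wordWeight a) f) := rfl

theorem norm_creation_le (c : WeightedL2 a) : ‖creation a c‖ ≤ ‖c‖ :=
  LinearMap.mkContinuous_norm_le _ (norm_nonneg _) _

theorem creation_add (c d : WeightedL2 a) : creation a (c + d) = creation a c + creation a d := by
  ext f
  refine coeff_injective (wordWeight a) (funext fun w => ?_)
  cases w with
  | nil => simp [coeff_creation, tensorCoeff]
  | cons i w => simp [coeff_creation, tensorCoeff, add_mul]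

theorem continuous_creation : Continuous (creation a) := by
  refine AddMonoidHomClass.continuous_of_bound
    (AddMonoidHom.mk' (creation a) (creation_add a)) 1 fun c => ?_
  rw [one_mul]
  exact norm_creation_le a c

theorem coeff_adjoint_creation (c : WeightedL2 a) (f : Fock a) (w : List ι) :
    coeff (wordWeight a) (ContinuousLinearMap.adjoint (creation a c) f) w =
      ∑' i, starRingEnd ℂ (coeff a c i) * coeff (wordWeight a) f (i :: w) * a i := by
  classical
  have hw : (wordWeight a w : ℂ) ≠ 0 := by exact_mod_cast (wordWeight_pos a w).ne'
  refine mul_right_cancel₀ hw ?_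
  have hinj : Function.Injective (fun i : ι => i :: w) := fun i j h => (List.cons.inj h).1
  rw [← inner_single, ContinuousLinearMap.adjoint_inner_right, inner_eq_tsum, ← tsum_mul_right,
    ← hinj.tsum_eq]
  · refine tsum_congr fun i => ?_
    simp only [coeff_creation, tensorCoeff, coeff_single, Pi.single_eq_same, mul_one,
      wordWeight_cons, Complex.ofReal_mul]
    ring
  · intro v hv
    cases v with
    | nil => simp [coeff_creation, tensorCoeff] at hv
    | cons i v =>
      by_cases h : v = w
      · exact ⟨i, by rw [h]⟩
      · simp [coeff_creation, tensorCoeff, coeff_single, h] at hv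

variable {a b} (hab : ∀ i, a i * b i = 1)

/-- The multiplication by the weight `b = a⁻¹` of a word, which identifies `Γ(ℓ²(ι, b))` with the
dual space `Γ(ℓ²(ι, a))`. -/
def toDual : Fock b →L[ℂ] Fock a :=
  diagonal (wordWeight a) (wordWeight b) (wordWeight b) fun w => by
    rw [sq, mul_assoc, mul_comm (wordWeight b w) (wordWeight a w),
      wordWeight_mul_wordWeight_eq_one hab, mul_one]

/-- The annihilation operator `ℓ_c^*` on `Γ(ℓ²(ι, b))` for `c` in the dual space `ℓ²(ι, a)` of
`ℓ²(ι, b)`: the transpose, under the dualities of the Fock spaces, of the creation operator on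
`Γ(ℓ²(ι, a))`. -/
def annihilation (c : WeightedL2 a) : Fock b →L[ℂ] Fock b :=
  toDual (fun i => (mul_comm _ _).trans (hab i)) ∘L
    ContinuousLinearMap.adjoint (creation a c) ∘L toDual hab

theorem coeff_annihilation (c : WeightedL2 a) (f : Fock b) (w : List ι) :
    coeff (wordWeight b) (annihilation hab c f) w =
      ∑' i, starRingEnd ℂ (coeff a c i) * coeff (wordWeight b) f (i :: w) := by
  have hi (i : ι) : (a i : ℂ) * b i = 1 := by exact_mod_cast hab i
  have hw : (wordWeight a w : ℂ) * wordWeight b w = 1 := by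
    exact_mod_cast wordWeight_mul_wordWeight_eq_one hab w
  simp only [annihilation, toDual, ContinuousLinearMap.comp_apply, coeff_diagonal,
    coeff_adjoint_creation, ← tsum_mul_left, wordWeight_cons, Complex.ofReal_mul]
  refine tsum_congr fun i => ?_
  linear_combination starRingEnd ℂ (coeff a c i) * coeff (wordWeight b) f (i :: w) *
    (a i * b i * hw + hi i)

variable (hle : ∀ w, wordWeight a w ≤ wordWeight b w)

/-- The field operator `ℓ_c + ℓ_c^*`, which depends real linearly on `c ∈ ℓ²(ι, a)`, from
`Γ(ℓ²(ι, b))` to its dual space `Γ(ℓ²(ι, a))`. -/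
def dualField : WeightedL2 a →L[ℝ] Fock b →L[ℂ] Fock a :=
  letI J := inclusion (wordWeight a) (wordWeight b) hle
  AddMonoidHom.toRealLinearMap
    (AddMonoidHom.mk' (fun c => creation a c ∘L J + J ∘L annihilation hab c) fun c d => by
      simp only [annihilation, creation_add, map_add, ContinuousLinearMap.add_comp,
        ContinuousLinearMap.comp_add]
      abel)
    (by
      have hcreation := continuous_creation a
      have hadjoint : Continuous fun c => ContinuousLinearMap.adjoint (creation a c) :=
        (ContinuousLinearMap.adjoint (𝕜 := ℂ)).continuous.comp hcreation
      exact (hcreation.clm_comp continuous_const).add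
        (continuous_const.clm_comp
          (continuous_const.clm_comp (hadjoint.clm_comp continuous_const))))

/-- The coefficients of `(ℓ_c + ℓ_c^*) f`. -/
def fieldCoeff (c : ι → ℂ) (f : List ι → ℂ) (w : List ι) : ℂ :=
  tensorCoeff c f w + ∑' i, starRingEnd ℂ (c i) * f (i :: w)

theorem coeff_dualField (c : WeightedL2 a) (f : Fock b) :
    coeff (wordWeight a) (dualField hab hle c f) =
      fieldCoeff (coeff a c) (coeff (wordWeight b) f) := by
  ext w
  change coeff (wordWeight a) (creation a c (inclusion _ _ hle f) +
    inclusion _ _ hle (annihilation hab c f)) w = _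
  rw [map_add, Pi.add_apply, coeff_creation, coeff_inclusion, coeff_inclusion, coeff_annihilation,
    fieldCoeff]

theorem coeff_freeField (ha : ∀ i, a i = 1) (c : WeightedL2 a) (f : Fock a) :
    coeff (wordWeight a) (freeField a c f) =
      fieldCoeff (coeff a c) (coeff (wordWeight a) f) := by
  ext w
  simp only [freeField, fieldCoeff, add_apply, map_add, Pi.add_apply,
    coeff_creation, coeff_adjoint_creation, ha, Complex.ofReal_one, mul_one]

end Fock

/-! ### Field operators between the Kondratiev spaces -/

section Kondratiev

theorem continuous_testToFock (p : ℕ) : Continuous (testToFock p) :=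
  continuous_iff_le_induced.2 (iInf_le _ p)

theorem continuous_fockToDistribution (p : ℕ) : Continuous (fockToDistribution p) :=
  continuous_sInf_rng.2 fun _ ht => ht.2.2.2 p

theorem hermiteWeight_neg_mul (p : ℤ) (n : ℕ) :
    hermiteWeight (-p) n * hermiteWeight p n = 1 := by
  have hn : (2 * ((n : ℝ) + 1)) ≠ 0 := by positivity
  rw [hermiteWeight, hermiteWeight, ← zpow_add₀ hn, neg_add_cancel, zpow_zero]

theorem hermiteWeight_mono {p q : ℤ} (h : p ≤ q) (n : ℕ) : hermiteWeight p n ≤ hermiteWeight q n :=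
  zpow_le_zpow_right₀ (by linarith [(Nat.cast_nonneg n : (0 : ℝ) ≤ n)]) h

/-- The inclusion of `L²(ℝ) = H_0` into `H_{-p}`. -/
def toNegativeOrder (p : ℕ) : HermiteSpace 0 →L[ℂ] HermiteSpace (-(p : ℤ)) :=
  inclusion _ _ (hermiteWeight_mono (by omega))

/-- The field operator `ℓ_c + ℓ_c^*` from `Γ(H_p)` to `Γ(H_{-p})`, for `c ∈ H_{-p}`. -/
def fieldOfOrder (p : ℕ) : HermiteSpace (-(p : ℤ)) →L[ℝ] FockH p →L[ℂ] FockH (-(p : ℤ)) :=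
  dualField (hermiteWeight_neg_mul p) (wordWeight_mono (by omega))

/-- The field operator `ℓ_c + ℓ_c^*` from `S̃₁` to `S̃₋₁`, for `c ∈ H_{-p}`. -/
def distributionField (p : ℕ) (c : HermiteSpace (-(p : ℤ))) :
    TestSpace →L[ℂ] DistributionSpace where
  toLinearMap := fockToDistribution p ∘ₗ (fieldOfOrder p c).toLinearMap ∘ₗ testToFock p
  cont := (continuous_fockToDistribution p).comp
    ((fieldOfOrder p c).continuous.comp (continuous_testToFock p))

theorem distributionField_apply (p : ℕ) (c : HermiteSpace (-(p : ℤ))) (f : TestSpace) :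
    distributionField p c f = fockToDistribution p (fieldOfOrder p c (testToFock p f)) := rfl

theorem whiteNoiseToDistribution_freeField (p : ℕ) (c : HermiteSpace 0) (f : TestSpace) :
    whiteNoiseToDistribution (freeField (hermiteWeight 0) c (testToWhiteNoise f)) =
      distributionField p (toNegativeOrder p c) f := by
  have hfree : coeff (wordWeight (hermiteWeight 0))
      (freeField (hermiteWeight 0) c (testToWhiteNoise f)) =
        fieldCoeff (coeff (hermiteWeight 0) c) f.1 :=
    coeff_freeField (a := hermiteWeight 0) (fun n => zpow_zero _) c (testToWhiteNoise f)
  have hdual : coeff (wordWeight (hermiteWeight (-(p : ℤ))))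
      (fieldOfOrder p (toNegativeOrder p c) (testToFock p f)) =
        fieldCoeff (coeff (hermiteWeight (-(p : ℤ))) (toNegativeOrder p c)) f.1 :=
    coeff_dualField _ _ _ _
  refine Subtype.ext (hfree.trans (Eq.trans ?_ hdual.symm))
  rw [toNegativeOrder, coeff_inclusion]

theorem tendsto_slope_distributionField {p : ℕ} {c : ℝ → HermiteSpace (-(p : ℤ))}
    {c' : HermiteSpace (-(p : ℤ))} {t : ℝ} (hc : HasDerivAt c c' t) (f : TestSpace) :
    Tendsto (fun h : ℝ => h⁻¹ • (distributionField p (c (t + h)) f - distributionField p (c t) f))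
      (𝓝[≠] 0) (𝓝 (distributionField p c' f)) := by
  have hfield : HasDerivAt (fun s => fieldOfOrder p (c s) (testToFock p f))
      (fieldOfOrder p c' (testToFock p f)) t :=
    (((ContinuousLinearMap.apply ℂ (FockH (-(p : ℤ))) (testToFock p f)).restrictScalars ℝ) ∘L
      fieldOfOrder p).hasFDerivAt.comp_hasDerivAt t hc
  refine (((continuous_fockToDistribution p).tendsto _).comp
    hfield.tendsto_slope_zero).congr fun h => ?_
  simp only [Function.comp_apply, distributionField_apply, LinearMap.map_smul_of_tower, map_sub]

end Kondratiev

/-! ### The Fourier transform on `L¹ ∩ L²` -/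

section Fourier

open scoped SchwartzMap ContDiff

variable {f g : ℝ → ℂ}

theorem continuous_fourier (hf : Integrable f) : Continuous (𝓕 f) :=
  VectorFourier.fourierIntegral_continuous Real.continuous_fourierChar continuous_inner hf

theorem integral_fourier_mul_eq (hf : Integrable f) (hg : Integrable g) :
    ∫ v, 𝓕 f v * g v = ∫ x, f x * 𝓕 g x := by
  have h := VectorFourier.integral_fourierIntegral_smul_eq_flip (L := innerₗ ℝ) (μ := volume)
    (ν := volume) Real.continuous_fourierChar continuous_inner hf hg
  rwa [flip_innerₗ] at h

theorem fourier_toLp_ae_eq (h1 : Integrable f) (h2 : MemLp f 2) :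
    (𝓕 (h2.toLp f : L2R) : L2R) =ᵐ[volume] 𝓕 f := by
  refine ae_eq_of_integral_contDiff_smul_eq
    ((Lp.memLp (𝓕 (h2.toLp f : L2R) : L2R)).locallyIntegrable (by norm_num))
    (continuous_fourier h1).locallyIntegrable fun g g_smooth g_cpt => ?_
  have hg_cpt : HasCompactSupport (Complex.ofRealCLM ∘ g) := g_cpt.comp_left rfl
  have hg_smooth : ContDiff ℝ ∞ (Complex.ofRealCLM ∘ g) := by fun_prop
  set φ : 𝓢(ℝ, ℂ) := hg_cpt.toSchwartzMap hg_smooth with hφ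
  have hφg (x : ℝ) : φ x = (g x : ℂ) := by simp [hφ]
  calc ∫ x, g x • (𝓕 (h2.toLp f : L2R) : L2R) x
      = ((𝓕 (h2.toLp f : L2R) : L2R) : 𝓢'(ℝ, ℂ)) φ := by
        simp [Lp.toTemperedDistribution_apply, hφg]
    _ = ((h2.toLp f : L2R) : 𝓢'(ℝ, ℂ)) (𝓕 φ) := by
        rw [← Lp.fourier_toTemperedDistribution_eq, TemperedDistribution.fourier_apply]
    _ = ∫ x, 𝓕 (φ : ℝ → ℂ) x * f x := by
        rw [Lp.toTemperedDistribution_apply]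
        refine integral_congr_ae ?_
        filter_upwards [h2.coeFn_toLp] with x hx
        rw [hx, SchwartzMap.fourier_coe, smul_eq_mul]
    _ = ∫ x, φ x * 𝓕 f x := integral_fourier_mul_eq φ.integrable h1
    _ = ∫ x, g x • 𝓕 f x := by simp [hφg]

theorem memLp_fourier (h1 : Integrable f) (h2 : MemLp f 2) : MemLp (𝓕 f) 2 :=
  (memLp_congr_ae (fourier_toLp_ae_eq h1 h2)).1 (Lp.memLp _)

theorem toLp_fourier (h1 : Integrable f) (h2 : MemLp f 2) :
    (memLp_fourier h1 h2).toLp (𝓕 f) = 𝓕 (h2.toLp f : L2R) :=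
  (MemLp.toLp_congr _ (Lp.memLp _) (fourier_toLp_ae_eq h1 h2).symm).trans (Lp.toLp_coeFn _ _)

theorem norm_toLp_sq (h2 : MemLp f 2) : ‖(h2.toLp f : L2R)‖ ^ 2 = ∫ x, ‖f x‖ ^ 2 := by
  rw [← Complex.ofReal_inj, Complex.ofReal_pow]
  refine (inner_self_eq_norm_sq_to_K (𝕜 := ℂ) (h2.toLp f : L2R)).symm.trans ?_
  rw [L2.inner_def, ← integral_complex_ofReal]
  refine integral_congr_ae ?_
  filter_upwards [h2.coeFn_toLp] with x hx
  rw [hx, inner_self_eq_norm_sq_to_K]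
  simp

theorem integral_norm_fourier_sq (h1 : Integrable f) (h2 : MemLp f 2) :
    ∫ v, ‖𝓕 f v‖ ^ 2 = ∫ x, ‖f x‖ ^ 2 := by
  rw [← norm_toLp_sq (memLp_fourier h1 h2), toLp_fourier h1 h2, Lp.norm_fourier_eq,
    norm_toLp_sq]

variable {f' : ℝ → ℂ}

theorem norm_fourier_deriv (hd : ∀ x, HasDerivAt f (f' x) x) (hf : Integrable f)
    (hf' : Integrable f') (v : ℝ) : ‖𝓕 f' v‖ = |2 * Real.pi * v| * ‖𝓕 f v‖ := by
  obtain rfl : deriv f = f' := funext fun x => (hd x).deriv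
  rw [Real.fourier_deriv hf (fun x => (hd x).differentiableAt) hf', norm_smul]
  simp [abs_mul]

theorem one_add_sq_mul_norm_fourier_sq (hd : ∀ x, HasDerivAt f (f' x) x) (hf : Integrable f)
    (hf' : Integrable f') (v : ℝ) :
    (1 + (2 * Real.pi * v) ^ 2) * ‖𝓕 f v‖ ^ 2 = ‖𝓕 f v‖ ^ 2 + ‖𝓕 f' v‖ ^ 2 := by
  rw [norm_fourier_deriv hd hf hf', mul_pow |_|, sq_abs]
  ring

theorem integrable_one_add_sq_mul_norm_fourier_sq (hd : ∀ x, HasDerivAt f (f' x) x)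
    (hf : Integrable f) (hf2 : MemLp f 2) (hf' : Integrable f') (hf2' : MemLp f' 2) :
    Integrable fun v => (1 + (2 * Real.pi * v) ^ 2) * ‖𝓕 f v‖ ^ 2 := by
  simp only [one_add_sq_mul_norm_fourier_sq hd hf hf']
  exact ((memLp_fourier hf hf2).integrable_norm_pow two_ne_zero).add
    ((memLp_fourier hf' hf2').integrable_norm_pow two_ne_zero)

theorem integral_one_add_sq_mul_norm_fourier_sq (hd : ∀ x, HasDerivAt f (f' x) x)
    (hf : Integrable f) (hf2 : MemLp f 2) (hf' : Integrable f') (hf2' : MemLp f' 2) :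
    ∫ v, (1 + (2 * Real.pi * v) ^ 2) * ‖𝓕 f v‖ ^ 2 = (∫ x, ‖f x‖ ^ 2) + ∫ x, ‖f' x‖ ^ 2 := by
  simp only [one_add_sq_mul_norm_fourier_sq hd hf hf']
  rw [integral_add ((memLp_fourier hf hf2).integrable_norm_pow two_ne_zero)
      ((memLp_fourier hf' hf2').integrable_norm_pow two_ne_zero),
    integral_norm_fourier_sq hf hf2, integral_norm_fourier_sq hf' hf2']

end Fourier

/-! ### The functions `1_{[0,t]}` -/

section Indicator

/-- The function `1_{[0,t]}`, which is `-1_{[t,0]}` for `t < 0`. -/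
def indicatorFun (t : ℝ) : ℝ → ℂ :=
  (Set.Icc 0 t).indicator 1 - (Set.Icc t 0).indicator 1

theorem integrable_indicatorFun (t : ℝ) : Integrable (indicatorFun t) :=
  ((integrable_indicator_iff measurableSet_Icc).2 (integrableOn_const measure_Icc_lt_top.ne)).sub
    ((integrable_indicator_iff measurableSet_Icc).2 (integrableOn_const measure_Icc_lt_top.ne))

theorem memLp_indicatorFun (t : ℝ) : MemLp (indicatorFun t) 2 :=
  (memLp_indicator_const 2 measurableSet_Icc 1 (Or.inr measure_Icc_lt_top.ne)).sub
    (memLp_indicator_const 2 measurableSet_Icc 1 (Or.inr measure_Icc_lt_top.ne))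

theorem toLp_indicatorFun (t : ℝ) : (memLp_indicatorFun t).toLp _ = signedIndicator t := rfl

theorem integral_mul_indicatorFun {g : ℝ → ℂ} (hg : Continuous g) (t : ℝ) :
    ∫ x, g x * indicatorFun t x = ∫ x in 0..t, g x := by
  have hmul (s : Set ℝ) (x : ℝ) : g x * s.indicator 1 x = s.indicator g x := by
    by_cases hx : x ∈ s <;> simp [hx]
  have hint (a b : ℝ) : Integrable ((Set.Icc a b).indicator g) :=
    (integrable_indicator_iff measurableSet_Icc).2 hg.continuousOn.integrableOn_Icc
  simp only [indicatorFun, Pi.sub_apply, mul_sub, hmul]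
  rw [integral_sub (hint 0 t) (hint t 0), integral_indicator measurableSet_Icc,
    integral_indicator measurableSet_Icc, integral_Icc_eq_integral_Ioc,
    integral_Icc_eq_integral_Ioc, intervalIntegral]

theorem fourier_indicatorFun (t v : ℝ) :
    𝓕 (indicatorFun t) v = ∫ x in 0..t, Complex.exp (-(2 * Real.pi * v : ℝ) * Complex.I * x) := by
  rw [Real.fourier_real_eq_integral_exp_smul, ← integral_mul_indicatorFun (by fun_prop)]
  refine integral_congr_ae (ae_of_all _ fun x => ?_)
  simp only [smul_eq_mul]
  congr 2
  push_cast
  ring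

theorem norm_exp_character (v x : ℝ) :
    ‖Complex.exp (-(2 * Real.pi * v : ℝ) * Complex.I * x)‖ = 1 := by
  rw [← Complex.norm_exp_ofReal_mul_I (-(2 * Real.pi * v) * x)]
  congr 2
  push_cast
  ring

theorem norm_fourier_indicatorFun_le (t v : ℝ) : ‖𝓕 (indicatorFun t) v‖ ≤ |t| := by
  rw [fourier_indicatorFun]
  simpa using intervalIntegral.norm_integral_le_of_norm_le_const (a := 0) (b := t) (C := 1)
    fun x _ => (norm_exp_character v x).le

theorem abs_mul_norm_fourier_indicatorFun_le (t v : ℝ) :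
    |2 * Real.pi * v| * ‖𝓕 (indicatorFun t) v‖ ≤ 2 := by
  rcases eq_or_ne v 0 with rfl | hv
  · simp
  have hc : (-(2 * Real.pi * v : ℝ) * Complex.I : ℂ) ≠ 0 := by
    simp [hv, Real.pi_ne_zero]
  have hnorm : ‖(-(2 * Real.pi * v : ℝ) * Complex.I : ℂ)‖ = |2 * Real.pi * v| := by
    rw [norm_mul, norm_neg, Complex.norm_real, Complex.norm_I, mul_one, Real.norm_eq_abs]
  rw [fourier_indicatorFun, integral_exp_mul_complex hc, ← hnorm, norm_div,
    mul_div_cancel₀ _ (norm_ne_zero_iff.2 hc)]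
  refine (norm_sub_le _ _).trans ?_
  rw [norm_exp_character, norm_exp_character]
  norm_num

theorem norm_fourier_indicatorFun_sq_le (t v : ℝ) :
    ‖𝓕 (indicatorFun t) v‖ ^ 2 ≤ (t ^ 2 + 4) / (1 + (2 * Real.pi * v) ^ 2) := by
  rw [le_div_iff₀ (by positivity)]
  have h1 := pow_le_pow_left₀ (norm_nonneg _) (norm_fourier_indicatorFun_le t v) 2
  have h2 := pow_le_pow_left₀ (by positivity) (abs_mul_norm_fourier_indicatorFun_le t v) 2
  rw [mul_pow, sq_abs] at h2
  rw [sq_abs] at h1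
  linarith

end Indicator

/-! ### Hermite functions -/

section Hermite

open Polynomial

theorem derivative_hermiteR (n : ℕ) :
    derivative (hermiteR n) = (n : Polynomial ℝ) * hermiteR (n - 1) := by
  induction n with
  | zero => simp [hermiteR]
  | succ n ih =>
    rcases n with _ | n
    · simp [hermiteR]
    · rw [hermiteR_succ (n + 1), derivative_sub, derivative_mul, derivative_X, ih,
        derivative_natCast_mul]
      simp only [Nat.add_sub_cancel]
      rw [hermiteR_succ n]
      push_cast
      ring

theorem hermiteFun_eq (n : ℕ) (u : ℝ) :
    hermiteFun n u = (hermiteR n).eval (Real.sqrt 2 * u) * Real.exp (-u ^ 2 / 2) /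
      (Real.pi ^ (1 / 4 : ℝ) * Real.sqrt n.factorial) := by
  rw [hermiteFun, hermiteR, aeval_def, eval_map]
  rfl

theorem integrable_hermiteFun (n : ℕ) : Integrable (hermiteFun n) := by
  refine ((integrable_poly_gauss ((hermiteR n).comp (C (Real.sqrt 2) * X))
    (by norm_num : (0 : ℝ) < 1 / 2)).div_const
      (Real.pi ^ (1 / 4 : ℝ) * Real.sqrt n.factorial)).congr (ae_of_all _ fun u => ?_)
  simp only [hermiteFun_eq, eval_comp, eval_mul, eval_C, eval_X]
  ring_nf

theorem natCast_div_sqrt_factorial (n : ℕ) :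
    (n : ℝ) / Real.sqrt n.factorial = Real.sqrt n / Real.sqrt (n - 1).factorial := by
  rcases n with _ | n
  · simp
  · rw [Nat.factorial_succ, Nat.cast_mul, Real.sqrt_mul (by positivity), Nat.add_sub_cancel,
      ← div_div, Real.div_sqrt]

theorem one_div_sqrt_factorial (n : ℕ) :
    1 / Real.sqrt n.factorial = Real.sqrt (n + 1) / Real.sqrt (n + 1).factorial := by
  rw [Nat.factorial_succ, Nat.cast_mul, Real.sqrt_mul (by positivity), Nat.cast_succ, ← div_div,
    div_self (by positivity)]

/-- For `n = 0` the first term vanishes, so that the value of `n - 1` is irrelevant. -/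
theorem hasDerivAt_hermiteFun (n : ℕ) (u : ℝ) :
    HasDerivAt (hermiteFun n)
      ((Real.sqrt n * hermiteFun (n - 1) u - Real.sqrt (n + 1) * hermiteFun (n + 1) u) /
        Real.sqrt 2) u := by
  set y := Real.sqrt 2 * u with hy
  have hpoly : HasDerivAt (fun u => (hermiteR n).eval (Real.sqrt 2 * u))
      ((derivative (hermiteR n)).eval y * Real.sqrt 2) u :=
    ((hermiteR n).hasDerivAt _).comp u (by simpa using (hasDerivAt_id u).const_mul (Real.sqrt 2))
  have hexp : HasDerivAt (fun u : ℝ => Real.exp (-u ^ 2 / 2))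
      (Real.exp (-u ^ 2 / 2) * -u) u := by
    have h : HasDerivAt (fun u : ℝ => -u ^ 2 / 2) (-u) u :=
      ((hasDerivAt_pow 2 u).neg.div_const 2).congr_deriv (by push_cast; ring)
    exact h.exp
  have hraise : (hermiteR (n + 1)).eval y =
      y * (hermiteR n).eval y - (derivative (hermiteR n)).eval y := by
    simp [hermiteR_succ]
  have hlower : (derivative (hermiteR n)).eval y = n * (hermiteR (n - 1)).eval y := by
    simp [derivative_hermiteR]
  rw [funext (hermiteFun_eq n)]
  refine ((hpoly.mul hexp).div_const (Real.pi ^ (1 / 4 : ℝ) * Real.sqrt n.factorial)).congr_deriv ?_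
  set E := Real.exp (-u ^ 2 / 2) / Real.pi ^ (1 / 4 : ℝ) with hE
  rw [eq_div_iff (by positivity)]
  calc _ = (2 * (derivative (hermiteR n)).eval y - y * (hermiteR n).eval y) * E *
          (1 / Real.sqrt n.factorial) := by
        rw [hE, hy]
        linear_combination (derivative (hermiteR n)).eval y * E * (1 / Real.sqrt n.factorial) *
          Real.mul_self_sqrt zero_le_two
    _ = (hermiteR (n - 1)).eval y * E * (n / Real.sqrt n.factorial) -
          (hermiteR (n + 1)).eval y * E * (1 / Real.sqrt n.factorial) := by
        rw [hraise]
        linear_combination E * (1 / Real.sqrt n.factorial) * hlower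
    _ = _ := by
        rw [natCast_div_sqrt_factorial, one_div_sqrt_factorial, hermiteFun_eq, hermiteFun_eq, hE]
        ring

theorem deriv_hermiteFun (n : ℕ) : deriv (hermiteFun n) = fun u =>
    (Real.sqrt n * hermiteFun (n - 1) u - Real.sqrt (n + 1) * hermiteFun (n + 1) u) / Real.sqrt 2 :=
  funext fun u => (hasDerivAt_hermiteFun n u).deriv

theorem integrable_deriv_hermiteFun (n : ℕ) : Integrable (deriv (hermiteFun n)) := by
  rw [deriv_hermiteFun]
  exact (((integrable_hermiteFun _).const_mul _).sub
    ((integrable_hermiteFun _).const_mul _)).div_const _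

theorem memLp_deriv_hermiteFun (n : ℕ) : MemLp (deriv (hermiteFun n)) 2 := by
  have h (k : ℕ) : MemLp (hermiteFun k) 2 := (memLp_hermiteFun k).re
  rw [deriv_hermiteFun]
  simp only [div_eq_inv_mul]
  exact (((h _).const_mul _).sub ((h _).const_mul _)).const_mul _

theorem integral_hermiteFun_sq (n : ℕ) : ∫ u, hermiteFun n u ^ 2 = 1 := by
  simpa [sq] using integral_hermiteFun_mul n n

theorem integral_deriv_hermiteFun_sq_le (n : ℕ) :
    ∫ u, deriv (hermiteFun n) u ^ 2 ≤ 2 * n + 1 := by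
  have hint (k : ℕ) : Integrable fun u => hermiteFun k u ^ 2 := by
    simpa only [sq] using integrable_hermiteFun_mul k k
  calc ∫ u, deriv (hermiteFun n) u ^ 2
      ≤ ∫ u, (n * hermiteFun (n - 1) u ^ 2 + (n + 1) * hermiteFun (n + 1) u ^ 2) := by
        refine integral_mono (memLp_deriv_hermiteFun n).integrable_sq
          (((hint _).const_mul _).add ((hint _).const_mul _)) fun u => ?_
        have hn : Real.sqrt n ^ 2 = n := Real.sq_sqrt (by positivity)
        have hn' : Real.sqrt (n + 1) ^ 2 = n + 1 := Real.sq_sqrt (by positivity)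
        simp only [deriv_hermiteFun, div_pow, Real.sq_sqrt zero_le_two]
        linear_combination (sq_nonneg (Real.sqrt n * hermiteFun (n - 1) u +
          Real.sqrt (n + 1) * hermiteFun (n + 1) u)) / 2 + hermiteFun (n - 1) u ^ 2 * hn +
          hermiteFun (n + 1) u ^ 2 * hn'
    _ = 2 * n + 1 := by
        rw [integral_add ((hint _).const_mul _) ((hint _).const_mul _), integral_const_mul,
          integral_const_mul, integral_hermiteFun_sq, integral_hermiteFun_sq]
        ring

theorem hasDerivAt_ofReal_hermiteFun (n : ℕ) (u : ℝ) :
    HasDerivAt (fun u => (hermiteFun n u : ℂ)) ((deriv (hermiteFun n) u : ℝ) : ℂ) u :=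
  (hasDerivAt_hermiteFun n u).differentiableAt.hasDerivAt.ofReal_comp

theorem integrable_one_add_sq_mul_norm_fourier_hermiteFun_sq (n : ℕ) :
    Integrable fun v =>
      (1 + (2 * Real.pi * v) ^ 2) * ‖𝓕 (fun u => (hermiteFun n u : ℂ)) v‖ ^ 2 :=
  integrable_one_add_sq_mul_norm_fourier_sq (hasDerivAt_ofReal_hermiteFun n)
    (integrable_hermiteFun n).ofReal (memLp_hermiteFun n)
    (integrable_deriv_hermiteFun n).ofReal (memLp_deriv_hermiteFun n).ofReal

theorem integral_one_add_sq_mul_norm_fourier_hermiteFun_sq_le (n : ℕ) :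
    ∫ v, (1 + (2 * Real.pi * v) ^ 2) * ‖𝓕 (fun u => (hermiteFun n u : ℂ)) v‖ ^ 2 ≤
      hermiteWeight 1 n := by
  rw [integral_one_add_sq_mul_norm_fourier_sq (hasDerivAt_ofReal_hermiteFun n)
    (integrable_hermiteFun n).ofReal (memLp_hermiteFun n)
    (integrable_deriv_hermiteFun n).ofReal (memLp_deriv_hermiteFun n).ofReal]
  simp only [Complex.norm_real, Real.norm_eq_abs, sq_abs, integral_hermiteFun_sq, hermiteWeight,
    zpow_one]
  linarith [integral_deriv_hermiteFun_sq_le n]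

end Hermite

/-! ### Regularity of `t ↦ T_m 1_{[0,t]}` -/

section Primitive

variable {w : ℝ → ℂ}

theorem differentiable_integral_fourier (hw : Integrable w) :
    Differentiable ℝ fun t => ∫ x in 0..t, 𝓕 w x :=
  intervalIntegral.differentiable_integral_of_continuous (continuous_fourier hw)

theorem norm_integral_fourier_sub_le (hw : Integrable w) (s r : ℝ) :
    ‖(∫ x in 0..s, 𝓕 w x) - ∫ x in 0..r, 𝓕 w x‖ ≤ (∫ v, ‖w v‖) * |s - r| := by
  have hint (a b : ℝ) := (continuous_fourier hw).intervalIntegrable (μ := volume) a b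
  rw [intervalIntegral.integral_interval_sub_left (hint 0 s) (hint 0 r)]
  exact intervalIntegral.norm_integral_le_of_norm_le_const fun x _ =>
    VectorFourier.norm_fourierIntegral_le_integral_norm _ _ _ w x

end Primitive

section Coefficients

variable {m : ℝ → ℝ} {f g : ℝ → ℂ}

/-- The function `v ↦ √(m (2πv)) (𝓕 f v)^*`, whose Fourier transform is the conjugate of `T_m f`.
Pairing with it replaces pairing with `T_m f` when `f` need not lie in the domain of `T_m`. -/
def dualSymbol (m : ℝ → ℝ) (f : ℝ → ℂ) (v : ℝ) : ℂ :=
  (Real.sqrt (m (2 * Real.pi * v)) : ℂ) * starRingEnd ℂ (𝓕 f v)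

theorem aemeasurable_comp_two_pi (hm_int : Integrable fun u => m u / (1 + u ^ 2)) :
    AEMeasurable fun v => m (2 * Real.pi * v) := by
  have hm : AEMeasurable m :=
    (hm_int.aemeasurable.mul (g := fun u => 1 + u ^ 2) (by fun_prop)).congr
      (ae_of_all _ fun u => div_mul_cancel₀ _ (by positivity))
  exact hm.comp_quasiMeasurePreserving
    (Measure.quasiMeasurePreserving_smul volume (r := 2 * Real.pi) (by positivity))

theorem integrable_comp_two_pi (hm_int : Integrable fun u => m u / (1 + u ^ 2)) :
    Integrable fun v => m (2 * Real.pi * v) / (1 + (2 * Real.pi * v) ^ 2) :=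
  hm_int.comp_mul_left' (by positivity)

theorem signedIndicator_mem_domain (hm_nonneg : ∀ u, 0 ≤ m u)
    (hm_int : Integrable fun u => m u / (1 + u ^ 2)) (t : ℝ) :
    signedIndicator t ∈ (opT m).domain := by
  have hsymbol : symbolMul m (signedIndicator t) =ᵐ[volume]
      fun v => (Real.sqrt (m (2 * Real.pi * v)) : ℂ) * 𝓕 (indicatorFun t) v := by
    filter_upwards [fourier_toLp_ae_eq (integrable_indicatorFun t) (memLp_indicatorFun t)] with v hv
    rw [symbolMul, ← toLp_indicatorFun, hv]
  have hmeas : AEStronglyMeasurable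
      fun v => (Real.sqrt (m (2 * Real.pi * v)) : ℂ) * 𝓕 (indicatorFun t) v :=
    (aemeasurable_comp_two_pi hm_int).sqrt.complex_ofReal.aestronglyMeasurable.mul
      (continuous_fourier (integrable_indicatorFun t)).aestronglyMeasurable
  refine (memLp_congr_ae hsymbol).2 ((memLp_two_iff_integrable_sq_norm hmeas).2 ?_)
  refine ((integrable_comp_two_pi hm_int).const_mul (t ^ 2 + 4)).mono' (hmeas.norm.pow 2)
    (ae_of_all _ fun v => ?_)
  calc ‖‖(Real.sqrt (m (2 * Real.pi * v)) : ℂ) * 𝓕 (indicatorFun t) v‖ ^ 2‖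
      = m (2 * Real.pi * v) * ‖𝓕 (indicatorFun t) v‖ ^ 2 := by
        rw [Real.norm_of_nonneg (by positivity), norm_mul, mul_pow, Complex.norm_real,
          Real.norm_of_nonneg (Real.sqrt_nonneg _), Real.sq_sqrt (hm_nonneg _)]
    _ ≤ m (2 * Real.pi * v) * ((t ^ 2 + 4) / (1 + (2 * Real.pi * v) ^ 2)) :=
        mul_le_mul_of_nonneg_left (norm_fourier_indicatorFun_sq_le t v) (hm_nonneg _)
    _ = (t ^ 2 + 4) * (m (2 * Real.pi * v) / (1 + (2 * Real.pi * v) ^ 2)) := by ring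

theorem norm_dualSymbol_le (hm_nonneg : ∀ u, 0 ≤ m u) (f : ℝ → ℂ) (v : ℝ) :
    ‖dualSymbol m f v‖ ≤ ((1 + (2 * Real.pi * v) ^ 2) * ‖𝓕 f v‖ ^ 2 +
      m (2 * Real.pi * v) / (1 + (2 * Real.pi * v) ^ 2)) / 2 := by
  rw [dualSymbol, norm_mul, RCLike.norm_conj, Complex.norm_real,
    Real.norm_of_nonneg (Real.sqrt_nonneg _)]
  set κ := 1 + (2 * Real.pi * v) ^ 2
  have hκ : 0 < κ := by positivity
  have amgm := two_mul_le_add_sq (Real.sqrt κ * ‖𝓕 f v‖)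
    (Real.sqrt (m (2 * Real.pi * v)) / Real.sqrt κ)
  rw [mul_pow, div_pow, Real.sq_sqrt hκ.le, Real.sq_sqrt (hm_nonneg _)] at amgm
  have hcancel : Real.sqrt κ * ‖𝓕 f v‖ * (Real.sqrt (m (2 * Real.pi * v)) / Real.sqrt κ) =
      Real.sqrt (m (2 * Real.pi * v)) * ‖𝓕 f v‖ := by
    field_simp
  linarith

theorem integrable_dualSymbol (hm_nonneg : ∀ u, 0 ≤ m u)
    (hm_int : Integrable fun u => m u / (1 + u ^ 2)) (hf : Integrable f)
    (hf_sobolev : Integrable fun v => (1 + (2 * Real.pi * v) ^ 2) * ‖𝓕 f v‖ ^ 2) :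
    Integrable (dualSymbol m f) :=
  ((hf_sobolev.add (integrable_comp_two_pi hm_int)).div_const 2).mono'
    ((aemeasurable_comp_two_pi hm_int).sqrt.complex_ofReal.aestronglyMeasurable.mul
      (Complex.continuous_conj.comp (continuous_fourier hf)).aestronglyMeasurable)
    (ae_of_all _ (norm_dualSymbol_le hm_nonneg f))

theorem integral_norm_dualSymbol_le (hm_nonneg : ∀ u, 0 ≤ m u)
    (hm_int : Integrable fun u => m u / (1 + u ^ 2))
    (hf_sobolev : Integrable fun v => (1 + (2 * Real.pi * v) ^ 2) * ‖𝓕 f v‖ ^ 2) :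
    ∫ v, ‖dualSymbol m f v‖ ≤ ((∫ v, (1 + (2 * Real.pi * v) ^ 2) * ‖𝓕 f v‖ ^ 2) +
      ∫ v, m (2 * Real.pi * v) / (1 + (2 * Real.pi * v) ^ 2)) / 2 := by
  rw [← integral_add hf_sobolev (integrable_comp_two_pi hm_int), ← integral_div]
  exact integral_mono_of_nonneg (ae_of_all _ fun v => norm_nonneg _)
    ((hf_sobolev.add (integrable_comp_two_pi hm_int)).div_const 2)
    (ae_of_all _ (norm_dualSymbol_le hm_nonneg f))

theorem inner_toLp_opT (hf : Integrable f) (hf2 : MemLp f 2) (hg : Integrable g)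
    (hg2 : MemLp g 2 volume) (hfm : Integrable (dualSymbol m f))
    (hdom : hg2.toLp g ∈ (opT m).domain) :
    ⟪(hf2.toLp f : L2R), opT m ⟨hg2.toLp g, hdom⟩⟫_ℂ = ∫ x, 𝓕 (dualSymbol m f) x * g x := by
  have hopT : opT m ⟨hg2.toLp g, hdom⟩ =
      (𝓕⁻ (MemLp.toLp (symbolMul m (hg2.toLp g)) hdom : L2R) : L2R) := rfl
  rw [hopT, ← Lp.inner_fourier_eq, FourierTransform.fourier_fourierInv_eq, L2.inner_def,
    integral_fourier_mul_eq hfm hg]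
  refine integral_congr_ae ?_
  filter_upwards [fourier_toLp_ae_eq hf hf2, fourier_toLp_ae_eq hg hg2, MemLp.coeFn_toLp hdom]
    with v hfv hgv hmulv
  rw [hfv, hmulv, symbolMul, hgv, RCLike.inner_apply, dualSymbol]
  ring

theorem integrable_dualSymbol_hermiteFun (hm_nonneg : ∀ u, 0 ≤ m u)
    (hm_int : Integrable fun u => m u / (1 + u ^ 2)) (n : ℕ) :
    Integrable (dualSymbol m fun u => (hermiteFun n u : ℂ)) :=
  integrable_dualSymbol hm_nonneg hm_int (integrable_hermiteFun n).ofReal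
    (integrable_one_add_sq_mul_norm_fourier_hermiteFun_sq n)

theorem integral_norm_dualSymbol_hermiteFun_le (hm_nonneg : ∀ u, 0 ≤ m u)
    (hm_int : Integrable fun u => m u / (1 + u ^ 2)) (n : ℕ) :
    ∫ v, ‖dualSymbol m (fun u => (hermiteFun n u : ℂ)) v‖ ≤
      (1 + ∫ v, m (2 * Real.pi * v) / (1 + (2 * Real.pi * v) ^ 2)) * hermiteWeight 1 n := by
  have hle := integral_one_add_sq_mul_norm_fourier_hermiteFun_sq_le n
  have hmass : 0 ≤ ∫ v, m (2 * Real.pi * v) / (1 + (2 * Real.pi * v) ^ 2) :=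
    integral_nonneg fun v => div_nonneg (hm_nonneg _) (by positivity)
  have hweight : 1 ≤ hermiteWeight 1 n := by
    rw [hermiteWeight, zpow_one]
    linarith [(Nat.cast_nonneg n : (0 : ℝ) ≤ n)]
  nlinarith [integral_norm_dualSymbol_le hm_nonneg hm_int
    (integrable_one_add_sq_mul_norm_fourier_hermiteFun_sq n)]

theorem coeff_hermiteCoeff_opT_signedIndicator (hm_nonneg : ∀ u, 0 ≤ m u)
    (hm_int : Integrable fun u => m u / (1 + u ^ 2)) {t : ℝ}
    (ht : signedIndicator t ∈ (opT m).domain) (n : ℕ) :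
    coeff (hermiteWeight 0) (hermiteCoeff (opT m ⟨signedIndicator t, ht⟩)) n =
      ∫ x in 0..t, 𝓕 (dualSymbol m fun u => (hermiteFun n u : ℂ)) x := by
  have hw := integrable_dualSymbol_hermiteFun hm_nonneg hm_int n
  rw [← integral_mul_indicatorFun (continuous_fourier hw)]
  exact inner_toLp_opT (integrable_hermiteFun n).ofReal (memLp_hermiteFun n)
    (integrable_indicatorFun t) (memLp_indicatorFun t) hw ht

theorem summable_hermiteWeight_neg_two : Summable (hermiteWeight (-2)) := by
  have h := ((summable_nat_add_iff 1).2
    (Real.summable_one_div_nat_pow.2 one_lt_two)).mul_left (1 / 4 : ℝ)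
  refine h.congr fun n => ?_
  rw [hermiteWeight, zpow_neg, zpow_ofNat, mul_pow, mul_inv, Nat.cast_succ]
  ring

theorem differentiable_hermiteCoeff_opT_signedIndicator (hm_nonneg : ∀ u, 0 ≤ m u)
    (hm_int : Integrable fun u => m u / (1 + u ^ 2))
    (hdom : ∀ t, signedIndicator t ∈ (opT m).domain) :
    Differentiable ℝ fun t =>
      toNegativeOrder 4 (hermiteCoeff (opT m ⟨signedIndicator t, hdom t⟩)) := by
  intro t
  set C := 1 + ∫ v, m (2 * Real.pi * v) / (1 + (2 * Real.pi * v) ^ 2)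
  have hw := integrable_dualSymbol_hermiteFun hm_nonneg hm_int
  have hle := integral_norm_dualSymbol_hermiteFun_le hm_nonneg hm_int
  have hcoeff (s : ℝ) (n : ℕ) :
      coeff (hermiteWeight (-((4 : ℕ) : ℤ)))
        (toNegativeOrder 4 (hermiteCoeff (opT m ⟨signedIndicator s, hdom s⟩))) n =
          ∫ x in 0..s, 𝓕 (dualSymbol m fun u => (hermiteFun n u : ℂ)) x := by
    rw [toNegativeOrder, coeff_inclusion,
      coeff_hermiteCoeff_opT_signedIndicator hm_nonneg hm_int]
  refine differentiableAt_of_coeff _ (B := fun n => C * hermiteWeight 1 n) ?_ ?_ ?_ ?_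
  · refine (summable_hermiteWeight_neg_two.mul_left (C ^ 2)).congr fun n => ?_
    have hbase : (2 * ((n : ℝ) + 1)) ≠ 0 := by positivity
    rw [mul_pow, mul_assoc, hermiteWeight, hermiteWeight, hermiteWeight, ← zpow_natCast (_ ^ _) 2,
      ← zpow_mul, ← zpow_add₀ hbase]
    rfl
  · exact fun n => (integral_nonneg fun v => norm_nonneg _).trans (hle n)
  · intro n s r
    rw [hcoeff, hcoeff]
    exact (norm_integral_fourier_sub_le (hw n) s r).trans
      (mul_le_mul_of_nonneg_right (hle n) (abs_nonneg _))
  · intro n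
    simp only [hcoeff]
    exact differentiable_integral_fourier (hw n) t

end Coefficients

end FreeNoise

end

open FreeNoise in
theorem theorem7p2_general (m : ℝ → ℝ) (hm_nonneg : ∀ u, 0 ≤ m u)
    (hm_int : Integrable (fun u : ℝ => m u / (1 + u ^ 2)) volume) :
    ∃ hdom : ∀ t : ℝ, signedIndicator t ∈ (opT m).domain,
      ∃ W : ℝ → (TestSpace →L[ℂ] DistributionSpace),
        ∀ (f : TestSpace) (t : ℝ),
          Tendsto
            (fun h : ℝ => h⁻¹ •
              (whiteNoiseToDistribution (freeProcess m hdom (t + h) (testToWhiteNoise f)) -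
                whiteNoiseToDistribution (freeProcess m hdom t (testToWhiteNoise f))))
            (𝓝[≠] 0) (𝓝 (W t f)) := by
  have hdom := signedIndicator_mem_domain hm_nonneg hm_int
  set c := fun t => toNegativeOrder 4 (hermiteCoeff (opT m ⟨signedIndicator t, hdom t⟩))
  have hc_deriv (t : ℝ) : HasDerivAt c (deriv c t) t :=
    (differentiable_hermiteCoeff_opT_signedIndicator hm_nonneg hm_int hdom t).hasDerivAt
  refine ⟨hdom, fun t => distributionField 4 (deriv c t), fun f t => ?_⟩
  simp only [freeProcess, whiteNoiseToDistribution_freeField 4]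
  exact tendsto_slope_distributionField (hc_deriv t) f

open FreeNoise in
theorem theorem7p2 (m : ℝ → ℝ) (hm_meas : AEMeasurable m volume) (hm_nonneg : ∀ u, 0 ≤ m u)
    (hm_int : Integrable (fun u : ℝ => m u / (1 + u ^ 2)) volume)
    (K b : ℝ) (N : ℕ) (hK : 0 < K) (hb : b < 2)
    (hm_small : ∀ u : ℝ, u ≠ 0 → |u| ≤ 1 → m u ≤ K * |u| ^ (-b))
    (hm_large : ∀ u : ℝ, 1 < |u| → m u ≤ K * |u| ^ (2 * N)) :
    ∃ hdom : ∀ t : ℝ, signedIndicator t ∈ (opT m).domain,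
      ∃ W : ℝ → (TestSpace →L[ℂ] DistributionSpace),
        ∀ (f : TestSpace) (t : ℝ),
          Tendsto
            (fun h : ℝ => h⁻¹ •
              (whiteNoiseToDistribution (freeProcess m hdom (t + h) (testToWhiteNoise f)) -
                whiteNoiseToDistribution (freeProcess m hdom t (testToWhiteNoise f))))
            (𝓝[≠] 0) (𝓝 (W t f)) :=
  theorem7p2_general m hm_nonneg hm_int
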